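/- Let $\mathcal H_A$ and $\mathcal H_B$ be arbitrary complex Hilbert spaces (of finite or infinite dimension, not necessarily separable) and let $\mathcal H_A\otimes\mathcal H_B$ be their Hilbert space tensor product. A state is a positive trace-class operator $\hat\varrho$ on $\mathcal H_A\otimes\mathcal H_B$ with $\operatorname{tr}\hat\varrho=1$. A state is separable if it is a limit, in trace norm, of finite convex combinations of pure product states $|a,b\rangle\langle a,b|$, where $|a,b\rangle=|a\rangle\otimes|b\rangle$ with $\langle a|a\rangle=\langle b|b\rangle=1$; it is entangled if it is not separable. For a bounded Hermitian operator $\hat A$ on $\mathcal H_A\otimes\mathcal H_B$ put $$f_{AB}(\hat A)=\sup\{\operatorname{tr}(\hat\sigma\hat A):\hat\sigma\ \text{a separable state}\}.$$ Then a state $\hat\varrho$ is entangled if and only if there is a bounded positive semidefinite operator $\hat C$ on $\mathcal H_A\otimes\mathcal H_B$ such that $$f_{AB}(\hat C)<\operatorname{tr}(\hat\varrho\,\hat C).$$ Moreover, for every bounded Hermitian operator $\hat A$, $$f_{AB}(\hat A)=\sup\{\langle a,b|\hat A|a,b\rangle:\ \langle a|a\rangle=\langle b|b\rangle=1\}.$$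 -/

import Mathlib

open scoped TensorProduct InnerProductSpace ENNReal

noncomputable section

namespace Entanglement

section Operators

variable {H : Type*} [NormedAddCommGroup H] [InnerProductSpace ℂ H]

/-- The trace norm `‖T‖₁ ∈ [0, ∞]` of a bounded operator: the supremum of `∑ i, |⟪f i, T (e i)⟫|`
over all pairs of finite orthonormal systems `e`, `f` of equal length. It is `tr |T|` if `T` is of
trace class, and `∞` if it is not. -/
def traceNorm (T : H →L[ℂ] H) : ℝ≥0∞ :=
  ⨆ (n : ℕ) (e : Fin n → H) (f : Fin n → H) (_ : Orthonormal ℂ e) (_ : Orthonormal ℂ f),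
    ∑ i, ‖⟪f i, T (e i)⟫_ℂ‖ₑ

/-- The index set (a maximal orthonormal set) of a fixed orthonormal basis of `H`. -/
def onbIndex (H : Type*) [NormedAddCommGroup H] [InnerProductSpace ℂ H] [CompleteSpace H] : Set H :=
  (exists_hilbertBasis ℂ H).choose

/-- A fixed orthonormal basis of the Hilbert space `H` (of arbitrary cardinality). -/
def onb (H : Type*) [NormedAddCommGroup H] [InnerProductSpace ℂ H] [CompleteSpace H] :
    HilbertBasis (onbIndex H) ℂ H :=
  (exists_hilbertBasis ℂ H).choose_spec.choose

/-- The trace `∑ᵢ ⟪eᵢ, T eᵢ⟫`. It is used for trace-class operators only; for these the sum converges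
absolutely and does not depend on the orthonormal basis. -/
def trace [CompleteSpace H] (T : H →L[ℂ] H) : ℂ :=
  ∑' i, ⟪onb H i, T (onb H i)⟫_ℂ

/-- Quantum states: positive trace-class operators of trace one. -/
structure IsState [CompleteSpace H] (ρ : H →L[ℂ] H) : Prop where
  isPositive : ρ.IsPositive
  traceClass : traceNorm ρ ≠ ∞
  trace_eq_one : trace ρ = 1

/-- The expectation value `tr (ρ A)`, a real number for a state `ρ` and a Hermitian `A`. -/
def expect [CompleteSpace H] (ρ A : H →L[ℂ] H) : ℝ :=
  (trace (ρ ∘L A)).re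

end Operators

section Bipartite

/-- The Hilbert space of the composite system: the completion of the algebraic tensor product with
inner product `⟪a ⊗ b, a' ⊗ b'⟫ = ⟪a, a'⟫ ⟪b, b'⟫`. -/
abbrev HilbertTensor (HA HB : Type*) [NormedAddCommGroup HA] [InnerProductSpace ℂ HA]
    [NormedAddCommGroup HB] [InnerProductSpace ℂ HB] : Type _ :=
  UniformSpace.Completion (HA ⊗[ℂ] HB)

variable {HA HB : Type*} [NormedAddCommGroup HA] [InnerProductSpace ℂ HA]
  [NormedAddCommGroup HB] [InnerProductSpace ℂ HB]

/-- The product vector `|a, b⟩ = |a⟩ ⊗ |b⟩`. -/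
def productVec (a : HA) (b : HB) : HilbertTensor HA HB :=
  ((a ⊗ₜ[ℂ] b : HA ⊗[ℂ] HB) : UniformSpace.Completion (HA ⊗[ℂ] HB))

/-- The pure product states `|a, b⟩⟨a, b|` with unit vectors `a`, `b`. -/
def pureProductStates (HA HB : Type*) [NormedAddCommGroup HA] [InnerProductSpace ℂ HA]
    [NormedAddCommGroup HB] [InnerProductSpace ℂ HB] :
    Set (HilbertTensor HA HB →L[ℂ] HilbertTensor HA HB) :=
  {P | ∃ (a : HA) (b : HB), ‖a‖ = 1 ∧ ‖b‖ = 1 ∧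
    P = InnerProductSpace.rankOne ℂ (productVec a b) (productVec a b)}

/-- Separable states: the states that are limits in trace norm of finite convex combinations of
pure product states. -/
structure IsSeparable (σ : HilbertTensor HA HB →L[ℂ] HilbertTensor HA HB) : Prop where
  isState : IsState σ
  approx : ∀ ε : ℝ≥0∞, 0 < ε →
    ∃ τ ∈ convexHull ℝ (pureProductStates HA HB), traceNorm (σ - τ) < ε

/-- Entangled states: the states that are not separable. -/
def IsEntangled (ρ : HilbertTensor HA HB →L[ℂ] HilbertTensor HA HB) : Prop :=
  IsState ρ ∧ ¬ IsSeparable ρ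

/-- `f_AB(A)`, the supremum of the expectation values of `A` in separable states. -/
def fAB (A : HilbertTensor HA HB →L[ℂ] HilbertTensor HA HB) : ℝ :=
  sSup {r : ℝ | ∃ σ : HilbertTensor HA HB →L[ℂ] HilbertTensor HA HB,
    IsSeparable σ ∧ r = expect σ A}

end Bipartite

end Entanglement

end

/-!
Expectation values are continuous in the trace norm (`abs_expect_le`), so the expectation of `A` in
a separable state, a trace-norm limit of convex combinations of pure product states, is at most the
supremum over unit product vectors (`IsSeparable.expect_le`). As pure product states are themselves
separable, this gives the formula for `f_AB` (`fAB_eq_sSup_productExpectations`), and it shows that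
`f_AB C < tr (ρ C)` excludes separability of `ρ`.

Conversely, an entangled `ρ` has positive trace-norm distance from the convex hull of the pure
product states. The Hahn–Banach theorem in the space of trace-class operators yields a continuous
functional `F` whose real part separates them (`exists_isSelfAdjoint_separating`). The sesquilinear
form `F |y⟩⟨x|` is bounded, hence given by a bounded operator, and its Hermitian part `A`
satisfies `re F T = tr (T A)` for positive `T`: this is clear for `T = |x⟩⟨x|`, and positive
trace-class operators are trace-norm limits of finite sums of such operators
(`exists_sum_rankOne_approx`). Finally `C = A + ‖A‖` is positive and separates as well, because all
states have trace one (`IsEntangled.exists_isPositive`).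

The trace norm being a supremum over orthonormal systems, three facts need an argument: the
trace-class operators are stable under composition with a bounded operator, since such an operator
is a combination of four unitaries (`traceNorm_comp_le`); rank-one operators satisfy
`‖|x⟩⟨y|‖₁ ≤ ‖x‖ ‖y‖` (`traceNorm_rankOne_le`); and for positive operators the trace norm is bounded
by the trace, by means of the square root (`traceNorm_le_trace`).
-/

noncomputable section

namespace Entanglement

/-! ### The trace norm -/

section TraceNorm

variable {H : Type*} [NormedAddCommGroup H] [InnerProductSpace ℂ H]

theorem sum_enorm_inner_le_traceNorm (T : H →L[ℂ] H) {ι : Type*} [Fintype ι] {e f : ι → H}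
    (he : Orthonormal ℂ e) (hf : Orthonormal ℂ f) :
    ∑ i, ‖⟪f i, T (e i)⟫_ℂ‖ₑ ≤ traceNorm T := by
  let g := (Fintype.equivFin ι).symm
  rw [← g.sum_comp]
  exact le_iSup_of_le _ <| le_iSup_of_le (e ∘ g) <| le_iSup_of_le (f ∘ g) <|
    le_iSup_of_le (he.comp g g.injective) <| le_iSup_of_le (hf.comp g g.injective) le_rfl

theorem traceNorm_le {T : H →L[ℂ] H} {c : ℝ≥0∞}
    (h : ∀ (n : ℕ) (e f : Fin n → H), Orthonormal ℂ e → Orthonormal ℂ f →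
      ∑ i, ‖⟪f i, T (e i)⟫_ℂ‖ₑ ≤ c) : traceNorm T ≤ c :=
  iSup_le fun n => iSup_le fun e => iSup_le fun f => iSup_le fun he => iSup_le fun hf =>
    h n e f he hf

@[simp]
theorem traceNorm_zero : traceNorm (0 : H →L[ℂ] H) = 0 :=
  le_antisymm (traceNorm_le fun _ _ _ _ _ => by simp) zero_le

theorem traceNorm_add_le (S T : H →L[ℂ] H) : traceNorm (S + T) ≤ traceNorm S + traceNorm T :=
  traceNorm_le fun n e f he hf => calc
    ∑ i, ‖⟪f i, (S + T) (e i)⟫_ℂ‖ₑ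
        ≤ ∑ i, (‖⟪f i, S (e i)⟫_ℂ‖ₑ + ‖⟪f i, T (e i)⟫_ℂ‖ₑ) :=
      Finset.sum_le_sum fun i _ => by
        rw [add_apply, inner_add_right]; exact enorm_add_le _ _
    _ ≤ _ := by
      rw [Finset.sum_add_distrib]
      exact add_le_add (sum_enorm_inner_le_traceNorm S he hf)
        (sum_enorm_inner_le_traceNorm T he hf)

theorem traceNorm_smul_le (c : ℂ) (T : H →L[ℂ] H) :
    traceNorm (c • T) ≤ ‖c‖ₑ * traceNorm T :=
  traceNorm_le fun n e f he hf => by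
    simp only [smul_apply, inner_smul_right, enorm_mul, ← Finset.mul_sum]
    gcongr
    exact sum_enorm_inner_le_traceNorm T he hf

theorem traceNorm_neg_le (T : H →L[ℂ] H) : traceNorm (-T) ≤ traceNorm T := by
  simpa using traceNorm_smul_le (-1) T

theorem traceNorm_sub_le (S T : H →L[ℂ] H) : traceNorm (S - T) ≤ traceNorm S + traceNorm T := by
  rw [sub_eq_add_neg]
  exact (traceNorm_add_le _ _).trans (add_le_add le_rfl (traceNorm_neg_le T))

theorem traceNorm_sum_le {ι : Type*} (s : Finset ι) (T : ι → H →L[ℂ] H) :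
    traceNorm (∑ i ∈ s, T i) ≤ ∑ i ∈ s, traceNorm (T i) := by
  classical
  induction s using Finset.induction_on with
  | empty => simp
  | insert i s hi ih =>
    rw [Finset.sum_insert hi, Finset.sum_insert hi]
    exact (traceNorm_add_le _ _).trans (add_le_add le_rfl ih)

/-- Composing with a unitary turns an orthonormal system into another one. -/
theorem traceNorm_comp_unitary_le [CompleteSpace H] (T : H →L[ℂ] H) (U : unitary (H →L[ℂ] H)) :
    traceNorm (T ∘L (U : H →L[ℂ] H)) ≤ traceNorm T :=
  traceNorm_le fun n e f he hf => by
    have hU : Orthonormal ℂ fun i => (U : H →L[ℂ] H) (e i) :=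
      he.comp_linearIsometryEquiv (Unitary.linearIsometryEquiv U)
    simpa using sum_enorm_inner_le_traceNorm T hU hf

/-- The trace-class operators form a right ideal. The bound is obtained by writing `A` as a
combination of four unitaries; the factor `2` could be removed, but plays no role here. -/
theorem traceNorm_comp_le [CompleteSpace H] (T A : H →L[ℂ] H) :
    traceNorm (T ∘L A) ≤ ENNReal.ofReal (2 * ‖A‖) * traceNorm T := by
  obtain ⟨u, c, hA, hc⟩ := CStarAlgebra.exists_sum_four_unitary A
  have h1 : T ∘L A = ∑ i, c i • (T ∘L (u i : H →L[ℂ] H)) := by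
    conv_lhs => rw [hA]
    ext x
    simp [map_sum]
  rw [h1]
  calc _ ≤ ∑ i, traceNorm (c i • (T ∘L (u i : H →L[ℂ] H))) := traceNorm_sum_le _ _
    _ ≤ ∑ _i : Fin 4, ENNReal.ofReal (‖A‖ / 2) * traceNorm T := by
      gcongr with i
      refine (traceNorm_smul_le _ _).trans ?_
      gcongr
      · rw [← ofReal_norm]; exact ENNReal.ofReal_le_ofReal (hc i)
      · exact traceNorm_comp_unitary_le _ _
    _ = _ := by
      rw [← Finset.sum_mul, Finset.sum_const, ← ENNReal.ofReal_nsmul]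
      congr 2
      simp
      ring

theorem traceNorm_comp_ne_top [CompleteSpace H] {T : H →L[ℂ] H} (hT : traceNorm T ≠ ∞)
    (A : H →L[ℂ] H) : traceNorm (T ∘L A) ≠ ∞ :=
  ne_top_of_le_ne_top (ENNReal.mul_ne_top ENNReal.ofReal_ne_top hT) (traceNorm_comp_le T A)

/-- By the Cauchy–Schwarz and Bessel inequalities. -/
theorem traceNorm_rankOne_le (x y : H) :
    traceNorm (InnerProductSpace.rankOne ℂ x y) ≤ ENNReal.ofReal (‖x‖ * ‖y‖) :=
  traceNorm_le fun n e f he hf => by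
    simp_rw [← ofReal_norm]
    rw [← ENNReal.ofReal_sum_of_nonneg fun _ _ => norm_nonneg _]
    apply ENNReal.ofReal_le_ofReal
    have hx := hf.sum_inner_products_le x (s := Finset.univ)
    have hy := he.sum_inner_products_le y (s := Finset.univ)
    calc ∑ i, ‖⟪f i, InnerProductSpace.rankOne ℂ x y (e i)⟫_ℂ‖
        = ∑ i, ‖⟪f i, x⟫_ℂ‖ * ‖⟪e i, y⟫_ℂ‖ := by
          refine Finset.sum_congr rfl fun i _ => ?_
          rw [InnerProductSpace.rankOne_apply, inner_smul_right, norm_mul, mul_comm,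
            norm_inner_symm y]
      _ ≤ √(∑ i, ‖⟪f i, x⟫_ℂ‖ ^ 2) * √(∑ i, ‖⟪e i, y⟫_ℂ‖ ^ 2) :=
          Real.sum_mul_le_sqrt_mul_sqrt _ _ _
      _ ≤ ‖x‖ * ‖y‖ := by
          gcongr
          · exact Real.sqrt_le_left (norm_nonneg _) |>.2 hx
          · exact Real.sqrt_le_left (norm_nonneg _) |>.2 hy

theorem traceNorm_rankOne_ne_top (x y : H) :
    traceNorm (InnerProductSpace.rankOne ℂ x y) ≠ ∞ :=
  ne_top_of_le_ne_top ENNReal.ofReal_ne_top (traceNorm_rankOne_le x y)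

theorem traceNorm_sum_rankOne_ne_top {ι : Type*} (s : Finset ι) (x : ι → H) :
    traceNorm (∑ i ∈ s, InnerProductSpace.rankOne ℂ (x i) (x i)) ≠ ∞ :=
  ne_top_of_le_ne_top (ENNReal.sum_ne_top.2 fun _ _ => traceNorm_rankOne_ne_top _ _)
    (traceNorm_sum_le _ _)

end TraceNorm

/-! ### The trace on trace-class operators -/

section Trace

variable {H : Type*} [NormedAddCommGroup H] [InnerProductSpace ℂ H] [CompleteSpace H]

theorem sum_norm_diag_le {T : H →L[ℂ] H} (hT : traceNorm T ≠ ∞) (s : Finset (onbIndex H)) :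
    ∑ i ∈ s, ‖⟪onb H i, T (onb H i)⟫_ℂ‖ ≤ (traceNorm T).toReal := by
  have he : Orthonormal ℂ fun i : s => onb H i :=
    (onb H).orthonormal.comp _ Subtype.val_injective
  have h := sum_enorm_inner_le_traceNorm T he he
  simp_rw [← ofReal_norm] at h
  rw [← ENNReal.ofReal_sum_of_nonneg fun _ _ => norm_nonneg _, ENNReal.ofReal_le_iff_le_toReal hT]
    at h
  rwa [← Finset.sum_coe_sort]

theorem summable_norm_diag {T : H →L[ℂ] H} (hT : traceNorm T ≠ ∞) :
    Summable fun i => ‖⟪onb H i, T (onb H i)⟫_ℂ‖ :=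
  summable_of_sum_le (fun _ => norm_nonneg _) (sum_norm_diag_le hT)

theorem hasSum_trace {T : H →L[ℂ] H} (hT : traceNorm T ≠ ∞) :
    HasSum (fun i => ⟪onb H i, T (onb H i)⟫_ℂ) (trace T) :=
  (summable_norm_diag hT).of_norm.hasSum

theorem norm_trace_le {T : H →L[ℂ] H} (hT : traceNorm T ≠ ∞) :
    ‖trace T‖ ≤ (traceNorm T).toReal :=
  (norm_tsum_le_tsum_norm (summable_norm_diag hT)).trans <|
    (summable_norm_diag hT).tsum_le_of_sum_le (sum_norm_diag_le hT)

theorem trace_add {S T : H →L[ℂ] H} (hS : traceNorm S ≠ ∞) (hT : traceNorm T ≠ ∞) :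
    trace (S + T) = trace S + trace T := by
  refine HasSum.tsum_eq ?_
  simpa [inner_add_right] using (hasSum_trace hS).add (hasSum_trace hT)

theorem trace_sub {S T : H →L[ℂ] H} (hS : traceNorm S ≠ ∞) (hT : traceNorm T ≠ ∞) :
    trace (S - T) = trace S - trace T := by
  refine HasSum.tsum_eq ?_
  simpa [inner_sub_right] using (hasSum_trace hS).sub (hasSum_trace hT)

theorem trace_smul (c : ℂ) (T : H →L[ℂ] H) : trace (c • T) = c * trace T := by
  simp [trace, tsum_mul_left]

theorem trace_rankOne_comp (x y : H) (A : H →L[ℂ] H) :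
    trace (InnerProductSpace.rankOne ℂ x y ∘L A) = ⟪y, A x⟫_ℂ := by
  have h := (onb H).tsum_inner_mul_inner (ContinuousLinearMap.adjoint A y) x
  rw [ContinuousLinearMap.adjoint_inner_left] at h
  simpa [trace, inner_smul_right, ContinuousLinearMap.adjoint_inner_left] using h

theorem trace_rankOne (x y : H) : trace (InnerProductSpace.rankOne ℂ x y) = ⟪y, x⟫_ℂ := by
  simpa using trace_rankOne_comp x y (ContinuousLinearMap.id ℂ H)

theorem trace_sum_rankOne {ι : Type*} (s : Finset ι) (x : ι → H) :
    trace (∑ i ∈ s, InnerProductSpace.rankOne ℂ (x i) (x i)) = ∑ i ∈ s, (‖x i‖ : ℂ) ^ 2 := by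
  classical
  induction s using Finset.induction_on with
  | empty => simp [trace]
  | insert i s hi ih =>
    rw [Finset.sum_insert hi, Finset.sum_insert hi, trace_add (traceNorm_rankOne_ne_top _ _)
      (traceNorm_sum_rankOne_ne_top _ _), ih, trace_rankOne, inner_self_eq_norm_sq_to_K]
    rfl

end Trace

/-! ### Expectation values -/

section Expect

variable {H : Type*} [NormedAddCommGroup H] [InnerProductSpace ℂ H] [CompleteSpace H]

theorem expect_add {S T : H →L[ℂ] H} (hS : traceNorm S ≠ ∞) (hT : traceNorm T ≠ ∞)
    (A : H →L[ℂ] H) : expect (S + T) A = expect S A + expect T A := by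
  simp [expect, ContinuousLinearMap.add_comp,
    trace_add (traceNorm_comp_ne_top hS A) (traceNorm_comp_ne_top hT A)]

theorem expect_sub {S T : H →L[ℂ] H} (hS : traceNorm S ≠ ∞) (hT : traceNorm T ≠ ∞)
    (A : H →L[ℂ] H) : expect (S - T) A = expect S A - expect T A := by
  simp [expect, ContinuousLinearMap.sub_comp,
    trace_sub (traceNorm_comp_ne_top hS A) (traceNorm_comp_ne_top hT A)]

theorem expect_smul (c : ℝ) (T A : H →L[ℂ] H) : expect (c • T) A = c * expect T A := by
  have h : (c • T) ∘L A = (c : ℂ) • (T ∘L A) := by ext x; simp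
  rw [expect, h, trace_smul, Complex.re_ofReal_mul, expect]

theorem abs_expect_le {T : H →L[ℂ] H} (hT : traceNorm T ≠ ∞) (A : H →L[ℂ] H) :
    |expect T A| ≤ 2 * ‖A‖ * (traceNorm T).toReal := by
  refine (Complex.abs_re_le_norm _).trans <| (norm_trace_le (traceNorm_comp_ne_top hT A)).trans ?_
  have h := ENNReal.toReal_mono (ENNReal.mul_ne_top ENNReal.ofReal_ne_top hT)
    (traceNorm_comp_le T A)
  rwa [ENNReal.toReal_mul, ENNReal.toReal_ofReal (by positivity)] at h

theorem expect_rankOne_self (x : H) (A : H →L[ℂ] H) :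
    expect (InnerProductSpace.rankOne ℂ x x) A = (⟪x, A x⟫_ℂ).re := by
  rw [expect, trace_rankOne_comp]

theorem expect_add_smul_one {T : H →L[ℂ] H} (hT : traceNorm T ≠ ∞) (A : H →L[ℂ] H) (c : ℝ) :
    expect T (A + c • 1) = expect T A + c * (trace T).re := by
  have h : T ∘L (A + c • 1) = T ∘L A + (c : ℂ) • T := by ext x; simp
  rw [expect, h, trace_add (traceNorm_comp_ne_top hT A), trace_smul]
  · simp [expect]
  · exact ne_top_of_le_ne_top (ENNReal.mul_ne_top (by simp) hT) (traceNorm_smul_le _ _)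

theorem isState_rankOne {x : H} (hx : ‖x‖ = 1) : IsState (InnerProductSpace.rankOne ℂ x x) where
  isPositive := InnerProductSpace.isPositive_rankOne_self x
  traceClass := traceNorm_rankOne_ne_top x x
  trace_eq_one := by rw [trace_rankOne, inner_self_eq_norm_sq_to_K, hx]; simp

end Expect

/-! ### Approximation of positive trace-class operators by finite rank -/

section Approximation

variable {H : Type*} [NormedAddCommGroup H] [InnerProductSpace ℂ H] [CompleteSpace H]

theorem exists_selfAdjoint_sqrt {R : H →L[ℂ] H} (hR : R.IsPositive) :
    ∃ Q : H →L[ℂ] H, (∀ x y, ⟪Q x, y⟫_ℂ = ⟪x, Q y⟫_ℂ) ∧ ∀ x, R x = Q (Q x) := by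
  have h0 : 0 ≤ R := (ContinuousLinearMap.nonneg_iff_isPositive R).2 hR
  have hQ := (ContinuousLinearMap.nonneg_iff_isPositive _).1 (CFC.sqrt_nonneg R)
  refine ⟨CFC.sqrt R, hQ.inner_left_eq_inner_right, fun x => ?_⟩
  rw [← mul_apply_eq_comp, CFC.sqrt_mul_sqrt_self R h0]

/-- Parseval's identity for `Q x`. -/
theorem hasSum_norm_inner_sq {Q : H →L[ℂ] H} (hQ : ∀ x y, ⟪Q x, y⟫_ℂ = ⟪x, Q y⟫_ℂ) (x : H) :
    HasSum (fun i => ‖⟪x, Q (onb H i)⟫_ℂ‖ ^ 2) (‖Q x‖ ^ 2) := by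
  have h := Complex.hasSum_re ((onb H).hasSum_inner_mul_inner (Q x) (Q x))
  convert h using 2 with i
  · rw [← hQ, ← inner_conj_symm (onb H i), RCLike.mul_conj]
    norm_cast
  · rw [← inner_self_eq_norm_sq (𝕜 := ℂ)]; rfl

theorem hasSum_norm_sq_trace {R Q : H →L[ℂ] H} (hT : traceNorm R ≠ ∞)
    (hQ : ∀ x y, ⟪Q x, y⟫_ℂ = ⟪x, Q y⟫_ℂ) (hRQ : ∀ x, R x = Q (Q x)) :
    HasSum (fun i => ‖Q (onb H i)‖ ^ 2) (trace R).re := by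
  have h := Complex.hasSum_re (hasSum_trace hT)
  convert h using 2 with i
  rw [hRQ, ← hQ, ← inner_self_eq_norm_sq (𝕜 := ℂ)]; rfl

/-- The sum of `⟪f j, R (f j)⟫ = ‖Q (f j)‖²` over a finite orthonormal system does not exceed the
trace of `R = Q * Q`: expand `Q (f j)` in the basis, exchange the sums and apply Bessel's
inequality. -/
theorem sum_norm_sq_le_trace {R Q : H →L[ℂ] H} (hT : traceNorm R ≠ ∞)
    (hQ : ∀ x y, ⟪Q x, y⟫_ℂ = ⟪x, Q y⟫_ℂ) (hRQ : ∀ x, R x = Q (Q x))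
    {ι : Type*} [Fintype ι] {f : ι → H} (hf : Orthonormal ℂ f) :
    ∑ j, ‖Q (f j)‖ ^ 2 ≤ (trace R).re :=
  hasSum_le (fun i => hf.sum_inner_products_le (Q (onb H i)) (s := Finset.univ))
    (hasSum_sum fun j _ => hasSum_norm_inner_sq hQ (f j)) (hasSum_norm_sq_trace hT hQ hRQ)

/-- For a positive trace-class operator the trace norm is the trace; only this inequality is
needed. -/
theorem traceNorm_le_trace {R : H →L[ℂ] H} (hR : R.IsPositive) (hT : traceNorm R ≠ ∞) :
    traceNorm R ≤ ENNReal.ofReal (trace R).re := by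
  obtain ⟨Q, hQ, hRQ⟩ := exists_selfAdjoint_sqrt hR
  refine traceNorm_le fun n e f he hf => ?_
  simp_rw [← ofReal_norm]
  rw [← ENNReal.ofReal_sum_of_nonneg fun _ _ => norm_nonneg _]
  apply ENNReal.ofReal_le_ofReal
  calc ∑ i, ‖⟪f i, R (e i)⟫_ℂ‖
      ≤ ∑ i, (‖Q (f i)‖ ^ 2 + ‖Q (e i)‖ ^ 2) / 2 := by
        refine Finset.sum_le_sum fun i _ => ?_
        rw [hRQ, ← hQ]
        have := norm_inner_le_norm (𝕜 := ℂ) (Q (f i)) (Q (e i))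
        nlinarith [sq_nonneg (‖Q (f i)‖ - ‖Q (e i)‖)]
    _ = (∑ i, ‖Q (f i)‖ ^ 2 + ∑ i, ‖Q (e i)‖ ^ 2) / 2 := by
        rw [← Finset.sum_div, Finset.sum_add_distrib]
    _ ≤ (trace R).re := by
        linarith [sum_norm_sq_le_trace hT hQ hRQ he, sum_norm_sq_le_trace hT hQ hRQ hf]

/-- A positive trace-class operator `ρ = Q * Q` is the trace-norm limit of the partial sums of
`∑ i, |Q e i⟩⟨Q e i|`: the remainder is positive by Bessel's inequality, so its trace norm is its
trace, which is the tail of the series for the trace of `ρ`. -/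
theorem exists_sum_rankOne_approx {ρ : H →L[ℂ] H} (hρ : ρ.IsPositive) (hT : traceNorm ρ ≠ ∞)
    {ε : ℝ} (hε : 0 < ε) :
    ∃ (s : Finset (onbIndex H)) (x : onbIndex H → H),
      (traceNorm (ρ - ∑ i ∈ s, InnerProductSpace.rankOne ℂ (x i) (x i))).toReal < ε := by
  obtain ⟨Q, hQ, hρQ⟩ := exists_selfAdjoint_sqrt hρ
  obtain ⟨s, hs⟩ := ((hasSum_norm_sq_trace hT hQ hρQ).eventually
    (lt_mem_nhds (sub_lt_self (trace ρ).re hε))).exists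
  refine ⟨s, fun i => Q (onb H i), ?_⟩
  set S := ∑ i ∈ s, InnerProductSpace.rankOne ℂ (Q (onb H i)) (Q (onb H i)) with hS
  have hST : traceNorm S ≠ ∞ := traceNorm_sum_rankOne_ne_top _ _
  have hRT : traceNorm (ρ - S) ≠ ∞ :=
    ne_top_of_le_ne_top (ENNReal.add_ne_top.2 ⟨hT, hST⟩) (traceNorm_sub_le ρ S)
  have hSp : S.IsPositive :=
    ContinuousLinearMap.isPositive_sum _ fun i _ => InnerProductSpace.isPositive_rankOne_self _
  have hR : (ρ - S).IsPositive := by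
    rw [ContinuousLinearMap.isPositive_def']
    refine ⟨hρ.isSelfAdjoint.sub hSp.isSelfAdjoint, fun x => ?_⟩
    have h1 : ⟪S x, x⟫_ℂ = ((∑ i ∈ s, ‖⟪x, Q (onb H i)⟫_ℂ‖ ^ 2 : ℝ) : ℂ) := by
      simp only [hS, sum_apply, InnerProductSpace.rankOne_apply, sum_inner, inner_smul_left]
      push_cast
      refine Finset.sum_congr rfl fun i _ => ?_
      rw [inner_conj_symm, ← inner_conj_symm (Q _) x, RCLike.mul_conj]
      rfl
    have h2 : (⟪ρ x, x⟫_ℂ).re = ‖Q x‖ ^ 2 := by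
      rw [hρQ, hQ, ← inner_self_eq_norm_sq (𝕜 := ℂ)]; rfl
    rw [ContinuousLinearMap.reApplyInnerSelf_apply, sub_apply, inner_sub_left, h1, map_sub]
    simp only [RCLike.re_to_complex, h2, Complex.ofReal_re, sub_nonneg]
    exact sum_le_hasSum s (fun _ _ => sq_nonneg _) (hasSum_norm_inner_sq hQ x)
  have htr : (trace (ρ - S)).re = (trace ρ).re - ∑ i ∈ s, ‖Q (onb H i)‖ ^ 2 := by
    rw [trace_sub hT hST, trace_sum_rankOne, Complex.sub_re]
    norm_cast
  have h := traceNorm_le_trace hR hRT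
  rw [htr] at h
  refine (ENNReal.toReal_le_of_le_ofReal ?_ h).trans_lt (by linarith)
  exact sub_nonneg.2 <| sum_le_hasSum s (fun _ _ => sq_nonneg _) (hasSum_norm_sq_trace hT hQ hρQ)

end Approximation

/-! ### Functionals on the trace-class operators and separation -/

section Duality

variable {H : Type*} [NormedAddCommGroup H] [InnerProductSpace ℂ H]

/-- The subspace of trace-class operators. -/
def traceClass (H : Type*) [NormedAddCommGroup H] [InnerProductSpace ℂ H] :
    Submodule ℂ (H →L[ℂ] H) where
  carrier := {T | traceNorm T ≠ ∞}
  zero_mem' := by simp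
  add_mem' hS hT := ne_top_of_le_ne_top (ENNReal.add_ne_top.2 ⟨hS, hT⟩) (traceNorm_add_le _ _)
  smul_mem' c T hT :=
    ne_top_of_le_ne_top (ENNReal.mul_ne_top enorm_ne_top hT) (traceNorm_smul_le c T)

/-- The space of trace-class operators. It is a type synonym of the subspace `traceClass H`, so that
it carries the trace norm and not the operator norm. -/
def TraceClass (H : Type*) [NormedAddCommGroup H] [InnerProductSpace ℂ H] : Type _ :=
  traceClass H

instance : AddCommGroup (TraceClass H) := inferInstanceAs (AddCommGroup (traceClass H))

instance : Module ℂ (TraceClass H) := inferInstanceAs (Module ℂ (traceClass H))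

/-- The inclusion of the trace-class operators into the bounded operators. -/
def TraceClass.toCLM : TraceClass H →ₗ[ℂ] H →L[ℂ] H := (traceClass H).subtype

/-- A bounded operator of finite trace norm as an element of `TraceClass H`. -/
def TraceClass.mk (T : H →L[ℂ] H) (hT : traceNorm T ≠ ∞) : TraceClass H := ⟨T, hT⟩

theorem TraceClass.toCLM_injective : Function.Injective (TraceClass.toCLM (H := H)) :=
  Subtype.val_injective

@[simp]
theorem TraceClass.toCLM_mk (T : H →L[ℂ] H) (hT : traceNorm T ≠ ∞) :
    TraceClass.toCLM (TraceClass.mk T hT) = T := rfl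

theorem TraceClass.traceNorm_ne_top (T : TraceClass H) : traceNorm T.toCLM ≠ ∞ := T.2

instance : SeminormedAddCommGroup (TraceClass H) :=
  AddGroupSeminorm.toSeminormedAddCommGroup
    { toFun := fun T => (traceNorm T.toCLM).toReal
      map_zero' := by simp
      add_le' := fun S T => by
        rw [map_add, ← ENNReal.toReal_add S.traceNorm_ne_top T.traceNorm_ne_top]
        exact ENNReal.toReal_mono (ENNReal.add_ne_top.2 ⟨S.traceNorm_ne_top, T.traceNorm_ne_top⟩)
          (traceNorm_add_le _ _)
      neg' := fun T => by
        rw [map_neg]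
        congr 1
        refine le_antisymm (traceNorm_neg_le _) ?_
        simpa using traceNorm_neg_le (-T.toCLM) }

theorem TraceClass.norm_def (T : TraceClass H) : ‖T‖ = (traceNorm T.toCLM).toReal := rfl

instance : NormedSpace ℂ (TraceClass H) where
  norm_smul_le c T := by
    rw [TraceClass.norm_def, map_smul, TraceClass.norm_def, ← toReal_enorm, ← ENNReal.toReal_mul]
    exact ENNReal.toReal_mono (ENNReal.mul_ne_top enorm_ne_top T.traceNorm_ne_top)
      (traceNorm_smul_le _ _)

/-- The trace-class operator `|x⟩⟨y|`. -/
def TraceClass.rankOne (x y : H) : TraceClass H :=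
  TraceClass.mk (InnerProductSpace.rankOne ℂ x y) (traceNorm_rankOne_ne_top x y)

@[simp]
theorem TraceClass.toCLM_rankOne (x y : H) :
    (TraceClass.rankOne x y).toCLM = InnerProductSpace.rankOne ℂ x y := rfl

theorem TraceClass.rankOne_add_left (x x' y : H) :
    rankOne (x + x') y = rankOne x y + rankOne x' y :=
  toCLM_injective <| by simp

theorem TraceClass.rankOne_add_right (x y y' : H) :
    rankOne x (y + y') = rankOne x y + rankOne x y' :=
  toCLM_injective <| by simp

theorem TraceClass.rankOne_smul_left (c : ℂ) (x y : H) :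
    rankOne (c • x) y = c • rankOne x y :=
  toCLM_injective <| by simp

theorem TraceClass.rankOne_smul_right (c : ℂ) (x y : H) :
    rankOne x (c • y) = starRingEnd ℂ c • rankOne x y :=
  toCLM_injective <| by simp

theorem TraceClass.norm_rankOne_le (x y : H) : ‖TraceClass.rankOne x y‖ ≤ ‖x‖ * ‖y‖ :=
  ENNReal.toReal_le_of_le_ofReal (by positivity) (traceNorm_rankOne_le x y)

theorem traceNorm_ne_top_of_mem_convexHull_of_forall {s : Set (H →L[ℂ] H)}
    (hs : ∀ P ∈ s, traceNorm P ≠ ∞) {τ : H →L[ℂ] H} (hτ : τ ∈ convexHull ℝ s) :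
    traceNorm τ ≠ ∞ :=
  convexHull_min (t := ((traceClass H).restrictScalars ℝ : Set (H →L[ℂ] H))) hs
    (Submodule.convex _) hτ

variable [CompleteSpace H]

/-- The real functional `T ↦ re (tr (T A))` on the trace-class operators. -/
def expectₗ (A : H →L[ℂ] H) : TraceClass H →ₗ[ℝ] ℝ where
  toFun T := expect T.toCLM A
  map_add' S T := by rw [map_add, expect_add S.traceNorm_ne_top T.traceNorm_ne_top]
  map_smul' c T := by
    rw [← Complex.coe_smul, map_smul, Complex.coe_smul, expect_smul]; rfl

/-- A continuous functional `F` on the trace-class operators defines a bounded sesquilinear form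
`F |y⟩⟨x|`, whose operator represents `F` on rank-one operators; only its Hermitian part
contributes to the real part of `F |x⟩⟨x|`. -/
theorem exists_isSelfAdjoint_rankOne (F : StrongDual ℂ (TraceClass H)) :
    ∃ A : H →L[ℂ] H, IsSelfAdjoint A ∧
      ∀ x, (F (TraceClass.rankOne x x)).re = expect (InnerProductSpace.rankOne ℂ x x) A := by
  let B : H →L⋆[ℂ] H →L[ℂ] ℂ := LinearMap.mkContinuous₂
    (LinearMap.mk₂'ₛₗ (starRingEnd ℂ) (RingHom.id ℂ) (fun x y => F (TraceClass.rankOne y x))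
      (fun x x' y => by rw [TraceClass.rankOne_add_right, map_add])
      (fun c x y => by rw [TraceClass.rankOne_smul_right, map_smul])
      (fun x y y' => by rw [TraceClass.rankOne_add_left, map_add])
      (fun c x y => by rw [TraceClass.rankOne_smul_left, map_smul]; rfl)) ‖F‖
    (fun x y => by
      refine (F.le_opNorm _).trans ?_
      rw [mul_assoc, mul_comm ‖x‖]
      gcongr
      exact TraceClass.norm_rankOne_le y x)
  obtain ⟨G, hG⟩ : ∃ G : H →L[ℂ] H, ∀ x, ⟪G x, x⟫_ℂ = F (TraceClass.rankOne x x) :=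
    ⟨InnerProductSpace.continuousLinearMapOfBilin B,
      fun x => InnerProductSpace.continuousLinearMapOfBilin_apply B x x⟩
  refine ⟨(2⁻¹ : ℝ) • (G + star G),
    (IsSelfAdjoint.all (2⁻¹ : ℝ)).smul (IsSelfAdjoint.add_star_self G), fun x => ?_⟩
  have h1 : (⟪x, G x⟫_ℂ).re = (⟪G x, x⟫_ℂ).re := by
    rw [← inner_conj_symm, Complex.conj_re]
  rw [expect_rankOne_self, ← hG, ← Complex.coe_smul, smul_apply, inner_smul_right, Complex.re_ofReal_mul, add_apply,
    inner_add_right, Complex.add_re, ContinuousLinearMap.star_eq_adjoint,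
    ContinuousLinearMap.adjoint_inner_right, h1]
  ring

/-- On positive trace-class operators, the real part of a continuous functional is the expectation
of a bounded Hermitian operator: both are continuous in the trace norm, and they agree on finite
sums of the operators `|x⟩⟨x|`, which approximate positive operators. -/
theorem exists_isSelfAdjoint_re_eq_expect (F : StrongDual ℂ (TraceClass H)) :
    ∃ A : H →L[ℂ] H, IsSelfAdjoint A ∧ ∀ T : TraceClass H, T.toCLM.IsPositive →
      (F T).re = expect T.toCLM A := by
  obtain ⟨A, hA, hF⟩ := exists_isSelfAdjoint_rankOne F
  refine ⟨A, hA, fun T hT => ?_⟩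
  let D : TraceClass H →ₗ[ℝ] ℝ := (Complex.reLm ∘ₗ F.toLinearMap.restrictScalars ℝ) - expectₗ A
  have hD : ∀ S, D S = (F S).re - expect S.toCLM A := fun S => rfl
  have hDle : ∀ S, |D S| ≤ (‖F‖ + 2 * ‖A‖) * ‖S‖ := fun S => by
    rw [hD, add_mul]
    exact (abs_sub _ _).trans <| add_le_add ((Complex.abs_re_le_norm _).trans (F.le_opNorm S))
      (abs_expect_le S.traceNorm_ne_top A)
  have hK : 0 < ‖F‖ + 2 * ‖A‖ + 1 := by positivity
  rw [← sub_eq_zero, ← hD, ← abs_nonpos_iff]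
  refine le_of_forall_pos_lt_add fun ε hε => ?_
  obtain ⟨s, x, hs⟩ := exists_sum_rankOne_approx hT T.traceNorm_ne_top (div_pos hε hK)
  have h0 : D (∑ i ∈ s, TraceClass.rankOne (x i) (x i)) = 0 := by
    rw [map_sum]
    exact Finset.sum_eq_zero fun i _ => by rw [hD, hF, TraceClass.toCLM_rankOne, sub_self]
  have hn : ‖T - ∑ i ∈ s, TraceClass.rankOne (x i) (x i)‖ < ε / (‖F‖ + 2 * ‖A‖ + 1) := by
    simpa [TraceClass.norm_def] using hs
  have hDT : D T = D (T - ∑ i ∈ s, TraceClass.rankOne (x i) (x i)) := by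
    rw [map_sub, h0, sub_zero]
  rw [hDT, zero_add]
  refine (hDle _).trans_lt ?_
  rw [lt_div_iff₀ hK] at hn
  nlinarith [norm_nonneg (T - ∑ i ∈ s, TraceClass.rankOne (x i) (x i))]

/-- The Hahn–Banach separation theorem for the trace norm: a positive operator at positive distance
from a convex set is separated from its positive members by the expectation value of a bounded
Hermitian operator. -/
theorem exists_isSelfAdjoint_separating {ρ : H →L[ℂ] H} (hρ : ρ.IsPositive)
    (hT : traceNorm ρ ≠ ∞) {s : Set (H →L[ℂ] H)} (hs : Convex ℝ s) {ε : ℝ≥0∞} (hε : 0 < ε)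
    (hd : ∀ τ ∈ s, ε ≤ traceNorm (ρ - τ)) :
    ∃ A : H →L[ℂ] H, IsSelfAdjoint A ∧ ∃ u < expect ρ A,
      ∀ τ ∈ s, τ.IsPositive → traceNorm τ ≠ ∞ → expect τ A ≤ u := by
  let K : Set (TraceClass H) := TraceClass.toCLM ⁻¹' s
  have hK : Convex ℝ K := hs.linear_preimage (TraceClass.toCLM.restrictScalars ℝ)
  have hmem : TraceClass.mk ρ hT ∉ closure K := fun hcl => by
    obtain ⟨δ, hδ, hδε⟩ := ENNReal.lt_iff_exists_nnreal_btwn.1 hε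
    obtain ⟨τ, hτ, hdist⟩ := Metric.mem_closure_iff.1 hcl δ (by exact_mod_cast hδ)
    rw [dist_eq_norm, TraceClass.norm_def, map_sub, TraceClass.toCLM_mk] at hdist
    have hfin : traceNorm (ρ - τ.toCLM) ≠ ∞ := (TraceClass.mk ρ hT - τ).traceNorm_ne_top
    have h := (ENNReal.lt_ofReal_iff_toReal_lt hfin).2 hdist
    rw [ENNReal.ofReal_coe_nnreal] at h
    exact (h.trans hδε).not_ge (hd _ hτ)
  obtain ⟨F, u, hFK, hFρ⟩ := RCLike.geometric_hahn_banach_closed_point (𝕜 := ℂ)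
    hK.closure isClosed_closure hmem
  obtain ⟨A, hA, hFA⟩ := exists_isSelfAdjoint_re_eq_expect F
  refine ⟨A, hA, u, hFρ.trans_eq (hFA _ hρ), fun τ hτ hpos hτT => ?_⟩
  exact (hFA (TraceClass.mk τ hτT) hpos).symm.trans_le (hFK _ (subset_closure hτ)).le

theorem expect_le_of_mem_convexHull_of_forall {s : Set (H →L[ℂ] H)} {A : H →L[ℂ] H} {M : ℝ}
    (hs : ∀ P ∈ s, traceNorm P ≠ ∞) (hM : ∀ P ∈ s, expect P A ≤ M) {τ : H →L[ℂ] H}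
    (hτ : τ ∈ convexHull ℝ s) : expect τ A ≤ M := by
  have hconv : Convex ℝ {τ : H →L[ℂ] H | traceNorm τ ≠ ∞ ∧ expect τ A ≤ M} := by
    rintro S ⟨hS, hSA⟩ T ⟨hT, hTA⟩ p q hp hq hpq
    have hS' : traceNorm (p • S) ≠ ∞ := (traceClass H).smul_mem (p : ℂ) hS
    have hT' : traceNorm (q • T) ≠ ∞ := (traceClass H).smul_mem (q : ℂ) hT
    refine ⟨(traceClass H).add_mem hS' hT', ?_⟩
    rw [expect_add hS' hT', expect_smul, expect_smul]
    calc _ ≤ p * M + q * M := by gcongr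
      _ = _ := by rw [← add_mul, hpq, one_mul]
  have hsub : s ⊆ {τ : H →L[ℂ] H | traceNorm τ ≠ ∞ ∧ expect τ A ≤ M} :=
    fun P hP => ⟨hs P hP, hM P hP⟩
  exact (convexHull_min hsub hconv hτ).2

theorem isPositive_add_norm_smul_one {A : H →L[ℂ] H} (hA : IsSelfAdjoint A) :
    (A + ‖A‖ • (1 : H →L[ℂ] H)).IsPositive := by
  rw [← ContinuousLinearMap.nonneg_iff_isPositive, ← neg_le_iff_add_nonneg',
    ← Algebra.algebraMap_eq_smul_one]
  exact hA.neg.le_algebraMap_norm_self.trans_eq (by rw [norm_neg])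

end Duality

/-! ### Separable states and entanglement witnesses -/

section Bipartite

variable {HA HB : Type*} [NormedAddCommGroup HA] [InnerProductSpace ℂ HA]
  [NormedAddCommGroup HB] [InnerProductSpace ℂ HB]

/-- The expectation values `⟨a, b|A|a, b⟩` in unit product vectors. -/
def productExpectations (A : HilbertTensor HA HB →L[ℂ] HilbertTensor HA HB) : Set ℝ :=
  {r : ℝ | ∃ (a : HA) (b : HB), ‖a‖ = 1 ∧ ‖b‖ = 1 ∧
    r = (⟪productVec a b, A (productVec a b)⟫_ℂ).re}

theorem norm_productVec (a : HA) (b : HB) : ‖productVec a b‖ = ‖a‖ * ‖b‖ := by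
  rw [productVec, UniformSpace.Completion.norm_coe, TensorProduct.norm_tmul]

theorem norm_productVec_eq_one {a : HA} {b : HB} (ha : ‖a‖ = 1) (hb : ‖b‖ = 1) :
    ‖productVec a b‖ = 1 := by
  rw [norm_productVec, ha, hb, one_mul]

theorem isState_of_mem_pureProductStates {P : HilbertTensor HA HB →L[ℂ] HilbertTensor HA HB}
    (hP : P ∈ pureProductStates HA HB) : IsState P := by
  obtain ⟨a, b, ha, hb, rfl⟩ := hP
  exact isState_rankOne (norm_productVec_eq_one ha hb)

theorem isSeparable_of_mem_pureProductStates {P : HilbertTensor HA HB →L[ℂ] HilbertTensor HA HB}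
    (hP : P ∈ pureProductStates HA HB) : IsSeparable P where
  isState := isState_of_mem_pureProductStates hP
  approx ε hε := ⟨P, subset_convexHull ℝ _ hP, by simpa using hε⟩

theorem traceNorm_ne_top_of_mem_convexHull {τ : HilbertTensor HA HB →L[ℂ] HilbertTensor HA HB}
    (hτ : τ ∈ convexHull ℝ (pureProductStates HA HB)) : traceNorm τ ≠ ∞ :=
  traceNorm_ne_top_of_mem_convexHull_of_forall
    (fun _ hP => (isState_of_mem_pureProductStates hP).traceClass) hτ

theorem bddAbove_productExpectations (A : HilbertTensor HA HB →L[ℂ] HilbertTensor HA HB) :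
    BddAbove (productExpectations A) := by
  refine ⟨‖A‖, ?_⟩
  rintro r ⟨a, b, ha, hb, rfl⟩
  refine (Complex.re_le_norm _).trans <| (norm_inner_le_norm _ _).trans ?_
  have h := A.le_opNorm (productVec a b)
  rw [norm_productVec_eq_one ha hb] at h ⊢
  linarith

theorem expect_le_of_mem_convexHull {A τ : HilbertTensor HA HB →L[ℂ] HilbertTensor HA HB}
    (hτ : τ ∈ convexHull ℝ (pureProductStates HA HB)) :
    expect τ A ≤ sSup (productExpectations A) := by
  refine expect_le_of_mem_convexHull_of_forall
    (fun _ hP => (isState_of_mem_pureProductStates hP).traceClass) ?_ hτ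
  rintro P ⟨a, b, ha, hb, rfl⟩
  rw [expect_rankOne_self]
  exact le_csSup (bddAbove_productExpectations A) ⟨a, b, ha, hb, rfl⟩

theorem IsSeparable.expect_le {σ : HilbertTensor HA HB →L[ℂ] HilbertTensor HA HB}
    (hσ : IsSeparable σ) (A : HilbertTensor HA HB →L[ℂ] HilbertTensor HA HB) :
    expect σ A ≤ sSup (productExpectations A) := by
  refine le_of_forall_pos_le_add fun ε hε => ?_
  have hK : 0 < 2 * ‖A‖ + 1 := by positivity
  obtain ⟨τ, hτ, hστ⟩ := hσ.approx (ENNReal.ofReal (ε / (2 * ‖A‖ + 1)))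
    (ENNReal.ofReal_pos.2 (div_pos hε hK))
  have h1 := abs_expect_le hστ.ne_top A
  rw [expect_sub hσ.isState.traceClass (traceNorm_ne_top_of_mem_convexHull hτ)] at h1
  have h2 := ENNReal.toReal_le_of_le_ofReal (div_pos hε hK).le hστ.le
  rw [le_div_iff₀ hK] at h2
  nlinarith [expect_le_of_mem_convexHull (A := A) hτ, le_abs_self (expect σ A - expect τ A),
    ENNReal.toReal_nonneg (a := traceNorm (σ - τ))]

theorem IsSeparable.nonempty_productExpectations
    {σ : HilbertTensor HA HB →L[ℂ] HilbertTensor HA HB} (hσ : IsSeparable σ)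
    (A : HilbertTensor HA HB →L[ℂ] HilbertTensor HA HB) : (productExpectations A).Nonempty := by
  obtain ⟨τ, hτ, -⟩ := hσ.approx 1 one_pos
  obtain ⟨P, a, b, ha, hb, -⟩ := convexHull_nonempty_iff.1 ⟨τ, hτ⟩
  exact ⟨_, a, b, ha, hb, rfl⟩

theorem IsSeparable.expect_le_fAB {σ : HilbertTensor HA HB →L[ℂ] HilbertTensor HA HB}
    (hσ : IsSeparable σ) (A : HilbertTensor HA HB →L[ℂ] HilbertTensor HA HB) :
    expect σ A ≤ fAB A := by
  refine le_csSup ⟨sSup (productExpectations A), ?_⟩ ⟨σ, hσ, rfl⟩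
  rintro r ⟨σ', hσ', rfl⟩
  exact hσ'.expect_le A

theorem fAB_eq_sSup_productExpectations (A : HilbertTensor HA HB →L[ℂ] HilbertTensor HA HB) :
    fAB A = sSup (productExpectations A) := by
  rcases (productExpectations A).eq_empty_or_nonempty with h | h
  · -- Without unit product vectors there are no separable states, and both suprema are `sSup ∅`.
    rw [fAB, h]
    congr 1
    refine Set.eq_empty_of_forall_notMem ?_
    rintro r ⟨σ, hσ, -⟩
    exact (hσ.nonempty_productExpectations A).ne_empty h
  · have hmem : ∀ r ∈ productExpectations A, ∃ σ, IsSeparable σ ∧ r = expect σ A := by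
      rintro r ⟨a, b, ha, hb, rfl⟩
      exact ⟨_, isSeparable_of_mem_pureProductStates ⟨a, b, ha, hb, rfl⟩,
        (expect_rankOne_self _ A).symm⟩
    apply le_antisymm
    · refine csSup_le (h.mono hmem) ?_
      rintro r ⟨σ, hσ, rfl⟩
      exact hσ.expect_le A
    · refine csSup_le h fun r hr => ?_
      obtain ⟨σ, hσ, rfl⟩ := hmem r hr
      exact hσ.expect_le_fAB A

theorem IsEntangled.exists_isSelfAdjoint {ρ : HilbertTensor HA HB →L[ℂ] HilbertTensor HA HB}
    (hρ : IsEntangled ρ) :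
    ∃ A : HilbertTensor HA HB →L[ℂ] HilbertTensor HA HB, IsSelfAdjoint A ∧
      ∃ u < expect ρ A, ∀ r ∈ productExpectations A, r ≤ u := by
  have hsep : ∃ ε : ℝ≥0∞, 0 < ε ∧
      ∀ τ ∈ convexHull ℝ (pureProductStates HA HB), ε ≤ traceNorm (ρ - τ) := by
    by_contra! h
    exact hρ.2 ⟨hρ.1, h⟩
  obtain ⟨ε, hε, hd⟩ := hsep
  obtain ⟨A, hA, u, hu, hAu⟩ := exists_isSelfAdjoint_separating hρ.1.isPositive hρ.1.traceClass
    (convex_convexHull ℝ _) hε hd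
  refine ⟨A, hA, u, hu, ?_⟩
  rintro r ⟨a, b, ha, hb, rfl⟩
  rw [← expect_rankOne_self]
  have hP : InnerProductSpace.rankOne ℂ (productVec a b) (productVec a b) ∈
      pureProductStates HA HB := ⟨a, b, ha, hb, rfl⟩
  have hst := isState_of_mem_pureProductStates hP
  exact hAu _ (subset_convexHull ℝ _ hP) hst.isPositive hst.traceClass

/-- Adding a multiple of the identity makes the separating operator positive and shifts all
expectation values in states by the same amount. -/
theorem IsEntangled.exists_isPositive {ρ : HilbertTensor HA HB →L[ℂ] HilbertTensor HA HB}
    (hρ : IsEntangled ρ) :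
    ∃ C : HilbertTensor HA HB →L[ℂ] HilbertTensor HA HB, C.IsPositive ∧ fAB C < expect ρ C := by
  have hshift : ∀ {σ : HilbertTensor HA HB →L[ℂ] HilbertTensor HA HB}, IsState σ →
      ∀ A (c : ℝ), expect σ (A + c • 1) = expect σ A + c := fun hσ A c => by
    rw [expect_add_smul_one hσ.traceClass, hσ.trace_eq_one, Complex.one_re, mul_one]
  obtain ⟨A, hA, u, hu, hAu⟩ := hρ.exists_isSelfAdjoint
  rcases (productExpectations (A + ‖A‖ • 1)).eq_empty_or_nonempty with h | h
  · -- Without unit product vectors every state is entangled; here `fAB` is `sSup ∅ = 0`.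
    have h1 : productExpectations (1 : HilbertTensor HA HB →L[ℂ] HilbertTensor HA HB) = ∅ := by
      refine Set.eq_empty_of_forall_notMem ?_
      rintro r ⟨a, b, ha, hb, -⟩
      exact Set.eq_empty_iff_forall_notMem.1 h _ ⟨a, b, ha, hb, rfl⟩
    refine ⟨1, ContinuousLinearMap.isPositive_one, ?_⟩
    rw [fAB_eq_sSup_productExpectations, h1, Real.sSup_empty]
    have h2 : expect ρ 1 = 1 := by
      rw [expect, ContinuousLinearMap.one_def, ContinuousLinearMap.comp_id, hρ.1.trace_eq_one,
        Complex.one_re]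
    rw [h2]
    exact one_pos
  · refine ⟨A + ‖A‖ • 1, isPositive_add_norm_smul_one hA, ?_⟩
    rw [fAB_eq_sSup_productExpectations, hshift hρ.1]
    refine (csSup_le h ?_).trans_lt (add_lt_add_left hu ‖A‖)
    rintro r ⟨a, b, ha, hb, rfl⟩
    rw [← expect_rankOne_self, hshift (isState_rankOne (norm_productVec_eq_one ha hb)),
      expect_rankOne_self]
    gcongr
    exact hAu _ ⟨a, b, ha, hb, rfl⟩

end Bipartite

end Entanglement

end

theorem theorem1 {HA HB : Type*}
    [NormedAddCommGroup HA] [InnerProductSpace ℂ HA] [CompleteSpace HA]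
    [NormedAddCommGroup HB] [InnerProductSpace ℂ HB] [CompleteSpace HB] :
    (∀ ρ : Entanglement.HilbertTensor HA HB →L[ℂ] Entanglement.HilbertTensor HA HB,
      Entanglement.IsState ρ →
        (Entanglement.IsEntangled ρ ↔
          ∃ C : Entanglement.HilbertTensor HA HB →L[ℂ] Entanglement.HilbertTensor HA HB,
            C.IsPositive ∧ Entanglement.fAB C < Entanglement.expect ρ C)) ∧
    (∀ A : Entanglement.HilbertTensor HA HB →L[ℂ] Entanglement.HilbertTensor HA HB,
      IsSelfAdjoint A →
        Entanglement.fAB A =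
          sSup {r : ℝ | ∃ (a : HA) (b : HB), ‖a‖ = 1 ∧ ‖b‖ = 1 ∧
            r = (⟪Entanglement.productVec a b, A (Entanglement.productVec a b)⟫_ℂ).re}) := by
  refine ⟨fun ρ hρ => ⟨fun h => h.exists_isPositive, ?_⟩,
    fun A _ => Entanglement.fAB_eq_sSup_productExpectations A⟩
  rintro ⟨C, -, hC⟩
  exact ⟨hρ, fun hsep => hC.not_ge (hsep.expect_le_fAB C)⟩
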